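/- All graphs are simple and undirected; Coxeter groups may have infinite rank. A subset $S$ of a group $W$ is a \emph{Coxeter basis} of $W$ if, for some symmetric $m:S\times S\to\{1,2,\dots,\infty\}$ with $m(s,s')=1\Leftrightarrow s=s'$, the group $W$ has the presentation with generators $S$ and relations $(ss')^{m(s,s')}=e$ for all $s,s'$ with $m(s,s')<\infty$; the basis is \emph{right-angled} if $m$ takes values in $\{1,2,\infty\}$. A right-angled Coxeter group $W$ is a group with a right-angled Coxeter basis $S$; its Coxeter graph $\Gamma_W$, which is unique up to isomorphism, has vertex set $S$, distinct $s,s'$ being adjacent iff $m(s,s')<\infty$. The group $W$ is \emph{strongly rigid} if any two Coxeter bases of $W$ are mapped to each other by an inner automorphism of $W$. A subgroup of $W$ is \emph{parabolic} if it is generated by a subset of some Coxeter basis of $W$. Let $\mathbf{K}'_*$ be a class of graphs, closed under isomorphism, and write $\leq$ for the induced subgraph relation between members of $\mathbf{K}'_*$. Suppose that $(\mathbf{K}'_*,\leq)$ is closed under limits, i.e. the union of every non-empty increasing continuous $\leq$-chain of members of $\mathbf{K}'_*$, indexed by an ordinal, is in $\mathbf{K}'_*$. Let $\mathbf{K}_*$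 be the class of right-angled Coxeter groups $A$ with $\Gamma_A\in\mathbf{K}'_*$, and suppose that every $B\in\mathbf{K}_*$ is strongly rigid. For $A,B\in\mathbf{K}_*$ write $A\preccurlyeq B$ if $A$ is a parabolic subgroup of $B$. Then: \begin{enumerate} \item $(\mathbf{K}_*,\preccurlyeq)$ satisfies all axioms of an abstract elementary class except possibly the Smoothness Axiom and the existence of a L\"owenheim--Skolem number. That is: $\mathbf{K}_*$ and $\preccurlyeq$ are closed under isomorphism; $A\preccurlyeq B$ implies $A\leq B$; $\preccurlyeq$ is a partial order on $\mathbf{K}_*$; if $(A_i)_{i<\delta}$, $\delta>0$, is an increasing continuous $\preccurlyeq$-chain in $\mathbf{K}_*$, then $\bigcup_{i<\delta}A_i\in\mathbf{K}_*$ and $A_j\preccurlyeq\bigcup_{i<\delta}A_i$ for every $j<\delta$; and if $A,B,C\in\mathbf{K}_*$, $A\preccurlyeq C$, $B\preccurlyeq C$ and $A\leq B$, then $A\preccurlyeq B$ (coherence). \item $\mathrm{LS}(\mathbf{K}_*,\preccurlyeq)=\mathrm{LS}(\mathbf{K}'_*,\leq)$, in the sense that one of the two numbers exists if and only if the other does,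 and then they are equal. Here the L\"owenheim--Skolem number $\mathrm{LS}(\mathbf{L},\trianglelefteq)$ of a class $\mathbf{L}$ of structures in a finite vocabulary is the least infinite cardinal $\kappa$ such that for every $A\in\mathbf{L}$ and every subset $X$ of $A$ there is $C\in\mathbf{L}$ with $X\subseteq C\trianglelefteq A$ and $|C|\leq|X|+\kappa$. \item If $(\mathbf{K}'_*,\leq)$ has the amalgamation property, then so does $(\mathbf{K}_*,\preccurlyeq)$; if $(\mathbf{K}'_*,\leq)$ has the joint embedding property, then so does $(\mathbf{K}_*,\preccurlyeq)$; and if $(\mathbf{K}'_*,\leq)$ has arbitrarily large models, then so does $(\mathbf{K}_*,\preccurlyeq)$. Here a $\trianglelefteq$-embedding $f:A\to B$ between members of $\mathbf{L}$ is an embedding with $f(A)\trianglelefteq B$. \emph{Amalgamation}: for all $\trianglelefteq$-embeddings $e_i:A\to B_i$ $(i=0,1)$ between members of $\mathbf{L}$ there are $C\in\mathbf{L}$ and $\trianglelefteq$-embeddings $f_i:B_i\to C$ with $f_0e_0=f_1e_1$. \emph{Joint embedding}: any two members of $\mathbf{L}$ have $\trianglelefteq$-embeddings into a common member of $\mathbf{L}$.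 \emph{Arbitrarily large models}: $\mathrm{LS}(\mathbf{L},\trianglelefteq)$ exists and $\mathbf{L}$ has a member of cardinality $\lambda$ for every cardinal $\lambda\geq\mathrm{LS}(\mathbf{L},\trianglelefteq)$. \end{enumerate} -/

import Mathlib

universe u

/-! ## Coxeter bases, strong rigidity, parabolic subgroups -/

namespace RACG

/-- `S` is a Coxeter basis of the group `W` with Coxeter matrix `M` (the entry `0` of `M` stands
for `∞`): `W` is presented by the generators `S` and the relations `(s * t) ^ M s t = 1`. -/
def IsBasisOfType {W : Type u} [Group W] (S : Set W) (M : CoxeterMatrix S) : Prop :=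
  ∃ cs : CoxeterSystem M W, ∀ s : S, cs.simple s = (s : W)

/-- `S` is a Coxeter basis (Coxeter generating set) of the group `W`. -/
def IsBasis {W : Type u} [Group W] (S : Set W) : Prop :=
  ∃ M : CoxeterMatrix S, IsBasisOfType S M

/-- A Coxeter matrix is right-angled if its entries are `1`, `2` or `∞` (the latter written `0`;
the entry `1` occurs exactly on the diagonal). -/
def IsRightAngled {S : Type u} (M : CoxeterMatrix S) : Prop :=
  ∀ s t : S, M s t = 1 ∨ M s t = 2 ∨ M s t = 0

/-- The Coxeter graph of a Coxeter matrix: distinct `s` and `t` are joined by an edge if and only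
if `m(s, t) < ∞`. For a right-angled matrix all edges carry the label `2`, so that this graph
without labels is the whole Coxeter graph. -/
def coxeterGraph {S : Type u} (M : CoxeterMatrix S) : SimpleGraph S where
  Adj s t := s ≠ t ∧ M s t ≠ 0
  symm := ⟨fun s t h => ⟨h.1.symm, by rw [M.symmetric]; exact h.2⟩⟩
  loopless := ⟨fun _ h => h.1 rfl⟩

/-- Any two Coxeter bases of `W` are mapped to each other by an inner automorphism. -/
def StronglyRigid (W : Type u) [Group W] : Prop :=
  ∀ S S' : Set W, IsBasis S → IsBasis S' → ∃ g : W, (fun x => g * x * g⁻¹) '' S = S'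

/-- `A` is a parabolic subgroup of `B`: it is generated by a subset of some Coxeter basis
of `B`. -/
def IsParabolic {B : Type u} [Group B] (A : Subgroup B) : Prop :=
  ∃ S : Set B, IsBasis S ∧ ∃ S' ⊆ S, A = Subgroup.closure S'

end RACG

/-! ## Classes of graphs with the induced subgraph relation -/

/-- A class of (simple, undirected) graphs. -/
abbrev GraphClass : Type (u + 1) := (V : Type u) → SimpleGraph V → Prop

namespace GraphClass

/-- The class is closed under isomorphism. -/
def IsoClosed (K : GraphClass.{u}) : Prop :=
  ∀ (V V' : Type u) (G : SimpleGraph V) (G' : SimpleGraph V'),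
    Nonempty (G ≃g G') → K V G → K V' G'

/-- The class is closed under unions of increasing continuous chains `(G_i)_{i < δ}` (with `δ > 0`)
of induced subgraphs. The union of the chain is called `G`, and its members are the graphs induced
by `G` on the sets `X i`. -/
def ClosedUnderLimits (K : GraphClass.{u}) : Prop :=
  ∀ (δ : Ordinal.{u}), 0 < δ → ∀ (V : Type u) (G : SimpleGraph V) (X : Ordinal.{u} → Set V),
    (∀ i < δ, K (X i) (G.induce (X i))) →
    (∀ i j, i ≤ j → j < δ → X i ⊆ X j) →
    (∀ i < δ, Order.IsSuccLimit i → X i = ⋃ j < i, X j) →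
    (⋃ i < δ, X i) = Set.univ →
    K V G

/-- The Löwenheim–Skolem property for the cardinal `κ` and the induced subgraph relation. The
number of symbols of the vocabulary, which is finite, is absorbed by `κ` when `κ` is infinite. -/
def HasLSProperty (K : GraphClass.{u}) (κ : Cardinal.{u}) : Prop :=
  ∀ (V : Type u) (G : SimpleGraph V), K V G → ∀ X : Set V,
    ∃ Y : Set V, X ⊆ Y ∧ K Y (G.induce Y) ∧ Cardinal.mk Y ≤ Cardinal.mk X + κ

/-- `κ` is the Löwenheim–Skolem number: the least infinite cardinal with the LS property. -/
def IsLSNumber (K : GraphClass.{u}) (κ : Cardinal.{u}) : Prop :=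
  IsLeast {μ : Cardinal.{u} | Cardinal.aleph0 ≤ μ ∧ K.HasLSProperty μ} κ

/-- The amalgamation property for induced subgraph embeddings. -/
def AP (K : GraphClass.{u}) : Prop :=
  ∀ (V V₀ V₁ : Type u) (A : SimpleGraph V) (B₀ : SimpleGraph V₀) (B₁ : SimpleGraph V₁),
    K V A → K V₀ B₀ → K V₁ B₁ → ∀ (e₀ : A ↪g B₀) (e₁ : A ↪g B₁),
    ∃ (U : Type u) (C : SimpleGraph U) (f₀ : B₀ ↪g C) (f₁ : B₁ ↪g C),
      K U C ∧ ∀ a : V, f₀ (e₀ a) = f₁ (e₁ a)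

/-- The joint embedding property for induced subgraph embeddings. -/
def JEP (K : GraphClass.{u}) : Prop :=
  ∀ (V₀ V₁ : Type u) (B₀ : SimpleGraph V₀) (B₁ : SimpleGraph V₁), K V₀ B₀ → K V₁ B₁ →
    ∃ (U : Type u) (C : SimpleGraph U), K U C ∧ Nonempty (B₀ ↪g C) ∧ Nonempty (B₁ ↪g C)

/-- Arbitrarily large models: the LS number exists, and every cardinal above it is the
cardinality of a member of the class. -/
def ALM (K : GraphClass.{u}) : Prop :=
  ∃ κ : Cardinal.{u}, K.IsLSNumber κ ∧
    ∀ μ ≥ κ, ∃ (V : Type u) (G : SimpleGraph V), K V G ∧ Cardinal.mk V = μ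

end GraphClass

/-! ## Classes of groups with a strong subgroup relation -/

/-- A class of groups. -/
abbrev GroupClass : Type (u + 1) := (W : Type u) → [Group W] → Prop

/-- A strong submodel relation `≼` on groups: `R B A` says that the subgroup `A` of `B` satisfies
`A ≼ B`. That `A ≼ B` implies `A ≤ B` is part of the type. -/
abbrev StrongRel : Type (u + 1) := (B : Type u) → [Group B] → Subgroup B → Prop

namespace GroupClass

/-- The axioms of an abstract elementary class for a class `K` of groups and a relation `R` (`≼`),
with the exception of the Smoothness Axiom and of the existence of a Löwenheim–Skolem number.
All groups occurring in one axiom are subgroups of a common group, namely the largest one of them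
or the union of the chain; for subgroups `A ≤ B` of a group, `A ≼ B` reads
`R B (A.subgroupOf B)`. The axiom `A ≼ B → A ≤ B` is built into `StrongRel`. -/
structure IsAECWithoutSmoothnessAndLS (K : GroupClass.{u}) (R : StrongRel.{u}) : Prop where
  /-- `K` is closed under isomorphism. -/
  class_iso : ∀ (B B' : Type u) [Group B] [Group B'], Nonempty (B ≃* B') → K B → K B'
  /-- `≼` is closed under isomorphism. -/
  rel_iso : ∀ (B B' : Type u) [Group B] [Group B'] (f : B ≃* B') (A : Subgroup B),
    R B A → R B' (A.map f.toMonoidHom)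
  /-- `≼` is a relation on `K`. -/
  rel_mem : ∀ (B : Type u) [Group B] (A : Subgroup B), R B A → K A ∧ K B
  /-- `≼` is reflexive on `K`. -/
  refl : ∀ (B : Type u) [Group B], K B → R B ⊤
  /-- `≼` is antisymmetric. -/
  antisymm : ∀ (M : Type u) [Group M] (A B : Subgroup M), A ≤ B → R B (A.subgroupOf B) →
    B ≤ A → R A (B.subgroupOf A) → A = B
  /-- `≼` is transitive. -/
  trans : ∀ (C : Type u) [Group C] (A B : Subgroup C), A ≤ B → R B (A.subgroupOf B) → R C B →
    R C A
  /-- The union `M` of an increasing continuous `≼`-chain `(A i)_{i < δ}`, `δ > 0`, belongs to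
  `K`, and every member of the chain satisfies `A j ≼ M`. -/
  chain : ∀ (δ : Ordinal.{u}), 0 < δ →
    ∀ (M : Type u) [Group M] (A : Ordinal.{u} → Subgroup M),
    (∀ i < δ, K (A i)) →
    (∀ i j, i ≤ j → j < δ → A i ≤ A j ∧ R (A j) ((A i).subgroupOf (A j))) →
    (∀ i < δ, Order.IsSuccLimit i → (A i : Set M) = ⋃ j < i, (A j : Set M)) →
    (⋃ i < δ, (A i : Set M)) = Set.univ →
    K M ∧ ∀ j < δ, R M (A j)
  /-- Coherence. -/
  coherence : ∀ (C : Type u) [Group C] (A B : Subgroup C), K A → K B → K C →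
    R C A → R C B → A ≤ B → R B (A.subgroupOf B)

/-- The Löwenheim–Skolem property for the cardinal `κ` and the relation `≼`. The number of symbols
of the vocabulary, which is finite, is absorbed by `κ` when `κ` is infinite. -/
def HasLSProperty (K : GroupClass.{u}) (R : StrongRel.{u}) (κ : Cardinal.{u}) : Prop :=
  ∀ (A : Type u) [Group A], K A → ∀ X : Set A,
    ∃ C : Subgroup A, X ⊆ (C : Set A) ∧ K C ∧ R A C ∧ Cardinal.mk C ≤ Cardinal.mk X + κ

/-- `κ` is the Löwenheim–Skolem number: the least infinite cardinal with the LS property. -/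
def IsLSNumber (K : GroupClass.{u}) (R : StrongRel.{u}) (κ : Cardinal.{u}) : Prop :=
  IsLeast {μ : Cardinal.{u} | Cardinal.aleph0 ≤ μ ∧ HasLSProperty K R μ} κ

/-- `f` is a `≼`-embedding. -/
def IsStrongEmbedding (R : StrongRel.{u}) {A B : Type u} [Group A] [Group B] (f : A →* B) : Prop :=
  Function.Injective f ∧ R B f.range

/-- The amalgamation property for `≼`-embeddings. -/
def AP (K : GroupClass.{u}) (R : StrongRel.{u}) : Prop :=
  ∀ (A B₀ B₁ : Type u) [Group A] [Group B₀] [Group B₁], K A → K B₀ → K B₁ →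
    ∀ (e₀ : A →* B₀) (e₁ : A →* B₁), IsStrongEmbedding R e₀ → IsStrongEmbedding R e₁ →
    ∃ (C : Type u) (_ : Group C) (f₀ : B₀ →* C) (f₁ : B₁ →* C), K C ∧
      IsStrongEmbedding R f₀ ∧ IsStrongEmbedding R f₁ ∧ ∀ a : A, f₀ (e₀ a) = f₁ (e₁ a)

/-- The joint embedding property for `≼`-embeddings. -/
def JEP (K : GroupClass.{u}) (R : StrongRel.{u}) : Prop :=
  ∀ (B₀ B₁ : Type u) [Group B₀] [Group B₁], K B₀ → K B₁ →
    ∃ (C : Type u) (_ : Group C) (f₀ : B₀ →* C) (f₁ : B₁ →* C), K C ∧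
      IsStrongEmbedding R f₀ ∧ IsStrongEmbedding R f₁

/-- Arbitrarily large models: the LS number exists, and every cardinal above it is the
cardinality of a member of the class. -/
def ALM (K : GroupClass.{u}) (R : StrongRel.{u}) : Prop :=
  ∃ κ : Cardinal.{u}, IsLSNumber K R κ ∧
    ∀ μ ≥ κ, ∃ (W : Type u) (_ : Group W), K W ∧ Cardinal.mk W = μ

end GroupClass

/-! ## The class of right-angled Coxeter groups given by a class of graphs -/

namespace RACG

/-- The class of right-angled Coxeter groups whose Coxeter graph (which is determined by the group
up to isomorphism) belongs to the class `K'` of graphs. -/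
def groupsOf (K' : GraphClass.{u}) : GroupClass.{u} := fun W _ =>
  ∃ (S : Set W) (M : CoxeterMatrix S),
    IsBasisOfType S M ∧ IsRightAngled M ∧ K' S (coxeterGraph M)

/-- The parabolic subgroup relation on the class `groupsOf K'`. -/
def parabolicRel (K' : GraphClass.{u}) : StrongRel.{u} := fun B _ A =>
  groupsOf K' A ∧ groupsOf K' B ∧ IsParabolic A

end RACG

/-!
The whole argument takes place among right-angled Coxeter groups, where the universal property of a
presentation does the work that the combinatorics of reduced words does for general Coxeter groups.

A set `S` in a group `M` is called independent (`RAIndep`) if it is a right-angled Coxeter basis of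
the subgroup it generates. Independence is formulated through words in `S`, so it is visibly
inherited by subsets and directed unions and transported along injective homomorphisms
(`RAIndep.mono`, `RAIndep.iUnion`, `RAIndep.image`); `isBasisOfType_iff` identifies it with the
definition by Coxeter systems. In a right-angled system two simple reflections commute if and only if
the corresponding entry of the matrix is finite (`commute_simple_iff`), so the Coxeter graph of a
basis is the commutation graph of that set (`coxeterGraph_eq_commGraph`).

Strong rigidity gives three facts. All Coxeter bases of a member of the class are conjugate, hence
right-angled and with a graph in the class (`IsRigidClass.of_isBasis`). If `A` is parabolic in `B`,
then every basis of `A` extends to a basis of `B` (`IsRigidClass.exists_extension`): conjugate a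
basis of `B` by a suitable element of `A`. Finally, parabolic subgroups `A ≤ B` of `C` are of the
form `A = g ⟨X⟩ g⁻¹` and `B = ⟨Y⟩` for subsets `X` and `Y` of one basis; the retraction of `C` onto
`⟨Y⟩` fixes `A` pointwise and shows that `X ⊆ Y` and that `g` may be chosen in `⟨Y⟩`
(`IsRigidClass.special_of_le`), which is coherence.

Transitivity and the chain axiom follow from the extension of bases: along a continuous chain one
chooses increasing bases, and their union is a basis of the union whose graph is the union of a
continuous chain of graphs (`IsRigidClass.chain`). For the Löwenheim–Skolem numbers, a set of group
elements is generated by few letters, and conversely a parabolic subgroup `g ⟨Y⟩ g⁻¹` that contains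
a set of generators contains these generators in `Y` (`RAIndep.mem_of_conj_mem_closure`).
Amalgamation and joint embedding are transferred by extending induced subgraph embeddings to
homomorphisms (`IsRigidClass.exists_strongEmbedding`).
-/

namespace RACG

open Function Set

/-! ### Right-angled independent sets -/

section Independent

variable {W : Type u} [Group W] {H : Type u} [Group H]

/-- The commutation graph of a set of group elements. For a right-angled Coxeter basis this is the
Coxeter graph, see `coxeterGraph_eq_commGraph`. -/
def commGraph (S : Set W) : SimpleGraph S where
  Adj s t := s ≠ t ∧ Commute (s : W) (t : W)
  symm := ⟨fun _ _ h => ⟨h.1.symm, h.2.symm⟩⟩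
  loopless := ⟨fun _ h => h.1 rfl⟩

/-- The values of `f` on `S` are involutions (or trivial) and satisfy all commutation relations
that hold in `S`. -/
structure Respects (S : Set W) (f : W → H) : Prop where
  sq : ∀ s ∈ S, f s * f s = 1
  comm : ∀ s ∈ S, ∀ t ∈ S, Commute s t → Commute (f s) (f t)

/-- `S` is a right-angled Coxeter basis of the subgroup it generates. This is expressed by words in
`S`, without mentioning that subgroup: whenever such a word is trivial, it remains trivial under
every assignment of values to the letters that respects the right-angled relations of `S`. -/
structure RAIndep (S : Set W) : Prop where
  sq : ∀ s ∈ S, s * s = 1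
  words : ∀ (H : Type u) [Group H] (f : W → H), Respects S f →
    ∀ l : List W, (∀ x ∈ l, x ∈ S) → l.prod = 1 → (l.map f).prod = 1

theorem exists_word_of_mem_closure {S : Set W} (hS : ∀ s ∈ S, s * s = 1) {x : W}
    (hx : x ∈ Subgroup.closure S) : ∃ l : List W, (∀ y ∈ l, y ∈ S) ∧ l.prod = x := by
  have hinv : S ∪ S⁻¹ = S := by
    refine union_eq_self_of_subset_right fun s hs => ?_
    have h := hS _ hs
    have : s = s⁻¹ := by
      have := eq_inv_of_mul_eq_one_left h
      simpa using this.symm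
    rw [this]
    exact hs
  have h : x ∈ (Subgroup.closure S).toSubmonoid := hx
  rw [Subgroup.closure_toSubmonoid, hinv] at h
  exact Submonoid.exists_list_of_mem_closure h

theorem RAIndep.mono {S T : Set W} (hT : RAIndep T) (h : S ⊆ T) : RAIndep S := by
  classical
  refine ⟨fun s hs => hT.sq s (h hs), fun H _ f hf l hl hl1 => ?_⟩
  have hg : Respects T (fun x => if x ∈ S then f x else 1) := by
    refine ⟨fun s _ => ?_, fun s _ t _ hst => ?_⟩
    · by_cases hs : s ∈ S <;> simp [hs, hf.sq]
    · by_cases hs : s ∈ S <;> by_cases ht : t ∈ S <;> simp [hs, ht, hf.comm, hst]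
  have := hT.words H _ hg l (fun x hx => h (hl x hx)) hl1
  rwa [List.map_congr_left (g := f) (fun x hx => if_pos (hl x hx))] at this

theorem RAIndep.image {S : Set W} (hS : RAIndep S) (f : W →* H) (hf : Injective f) :
    RAIndep (f '' S) := by
  refine ⟨?_, fun G _ g hg l hl hl1 => ?_⟩
  · rintro _ ⟨s, hs, rfl⟩
    rw [← map_mul, hS.sq s hs, map_one]
  · obtain ⟨l, rfl⟩ : l ∈ range (List.map f) := by
      rw [range_list_map]
      exact fun x hx => image_subset_range _ _ (hl x hx)
    have hgf : Respects S (g ∘ f) :=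
      ⟨fun s hs => hg.sq _ (mem_image_of_mem f hs), fun s hs t ht h =>
        hg.comm _ (mem_image_of_mem f hs) _ (mem_image_of_mem f ht) (h.map f)⟩
    rw [← map_list_prod, map_eq_one_iff f hf] at hl1
    have := hS.words G _ hgf l (fun x hx => hf.mem_set_image.1 (hl _ (List.mem_map_of_mem hx))) hl1
    rwa [List.map_map]

theorem RAIndep.of_image {S : Set W} (f : W →* H) (hf : Injective f) (hS : RAIndep (f '' S)) :
    RAIndep S := by
  refine ⟨fun s hs => hf ?_, fun G _ g hg l hl hl1 => ?_⟩
  · rw [map_mul, hS.sq _ (mem_image_of_mem f hs), map_one]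
  · have hinv : LeftInverse (invFun f) f := leftInverse_invFun hf
    have hg' : Respects (f '' S) (g ∘ invFun f) := by
      refine ⟨?_, ?_⟩
      · rintro _ ⟨s, hs, rfl⟩
        simpa [hinv s] using hg.sq s hs
      · rintro _ ⟨s, hs, rfl⟩ _ ⟨t, ht, rfl⟩ h
        simpa [hinv s, hinv t] using hg.comm s hs t ht (Commute.of_map hf h)
    have := hS.words G _ hg' (l.map f) (by
      intro x hx
      obtain ⟨y, hy, rfl⟩ := List.mem_map.1 hx
      exact mem_image_of_mem f (hl y hy)) (by rw [← map_list_prod, hl1, map_one])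
    rw [List.map_map] at this
    rwa [List.map_congr_left (g := g) (fun x _ => by simp [hinv x])] at this

/-- A word involves only finitely many letters, so independence passes to directed unions. -/
theorem RAIndep.iUnion {ι : Type*} [Nonempty ι] {S : ι → Set W} (hdir : Directed (· ⊆ ·) S)
    (hS : ∀ i, RAIndep (S i)) : RAIndep (⋃ i, S i) := by
  refine ⟨fun s hs => ?_, fun G _ g hg l hl hl1 => ?_⟩
  · obtain ⟨i, hi⟩ := mem_iUnion.1 hs
    exact (hS i).sq s hi
  · obtain ⟨i, hi⟩ : ∃ i, {x | x ∈ l} ⊆ S i :=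
      by
      classical
      simpa [subset_def] using hdir.exists_mem_subset_of_finset_subset_biUnion (s := l.toFinset)
        (fun x hx => hl x (by simpa using hx))
    refine (hS i).words G g ⟨fun s hs => hg.sq s (mem_iUnion_of_mem i hs), fun s hs t ht =>
      hg.comm s (mem_iUnion_of_mem i hs) t (mem_iUnion_of_mem i ht)⟩ l hi hl1

/-- Injective homomorphisms preserve commutation graphs. -/
noncomputable def commGraphIso (f : W →* H) (hf : Injective f) (S : Set W) :
    commGraph S ≃g commGraph (f '' S) where
  toEquiv := Equiv.Set.image f S hf
  map_rel_iff' := by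
    intro s t
    simp [commGraph, Subtype.ext_iff, commute_map_iff hf, hf.eq_iff]

end Independent

/-! ### Independent sets and right-angled Coxeter systems -/

section Coxeter

variable {V : Type u} {W : Type u} [Group W]

/-- The right-angled Coxeter matrix with a given Coxeter graph. -/
noncomputable def raMatrix (G : SimpleGraph V) : CoxeterMatrix V where
  M := by
    classical
    exact Matrix.of fun i j => if i = j then 1 else if G.Adj i j then 2 else 0
  isSymm := by
    ext i j
    by_cases h : i = j
    · simp [h]
    · by_cases hij : G.Adj i j
      · simp [h, Ne.symm h, hij, hij.symm]
      · simp [h, Ne.symm h, hij, G.adj_comm j i]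
  diagonal i := by simp
  off_diagonal i j h := by
    by_cases hij : G.Adj i j <;> simp [h, hij]

theorem isRightAngled_raMatrix (G : SimpleGraph V) : IsRightAngled (raMatrix G) := by
  intro i j
  by_cases h : i = j <;> by_cases hij : G.Adj i j <;> simp [raMatrix, h, hij]

theorem coxeterGraph_raMatrix (G : SimpleGraph V) : coxeterGraph (raMatrix G) = G := by
  ext i j
  by_cases h : i = j
  · simp [coxeterGraph, h]
  · by_cases hij : G.Adj i j <;> simp [coxeterGraph, raMatrix, h, hij]

theorem isLiftable_of_isRightAngled {M : CoxeterMatrix V} (hM : IsRightAngled M) {H : Type*}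
    [Group H] {f : V → H} (hsq : ∀ i, f i * f i = 1)
    (hcomm : ∀ i j, M i j = 2 → Commute (f i) (f j)) : M.IsLiftable f := by
  intro i j
  rcases hM i j with h | h | h
  · have hij : i = j := by
      by_contra hij
      exact M.off_diagonal i j hij h
    rw [h, hij, hsq, one_pow]
  · rw [h, (hcomm i j h).mul_pow, pow_two, pow_two, hsq, hsq, one_mul]
  · rw [h, pow_zero]

/-- Distinct simple reflections are separated by a homomorphism onto a group of order two. -/
theorem simple_injective {M : CoxeterMatrix V} (hM : IsRightAngled M) (cs : CoxeterSystem M W) :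
    Injective cs.simple := by
  classical
  intro i j h
  by_contra hij
  let a : Multiplicative (ZMod 2) := Multiplicative.ofAdd 1
  have hl : M.IsLiftable (fun k => if k = i then a else 1) :=
    isLiftable_of_isRightAngled hM (fun k => by split_ifs <;> decide)
      (fun _ _ _ => Commute.all _ _)
  have h' := congrArg (cs.lift ⟨_, hl⟩) h
  rw [cs.lift_apply_simple hl, cs.lift_apply_simple hl, if_pos rfl, if_neg (Ne.symm hij)] at h'
  exact absurd h' (by decide)

/-- If `m(i, j) = ∞`, a homomorphism to the symmetric group on three letters maps the simple
reflections `i` and `j` to two different transpositions. -/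
theorem commute_simple_iff {M : CoxeterMatrix V} (hM : IsRightAngled M) (cs : CoxeterSystem M W)
    (i j : V) : Commute (cs.simple i) (cs.simple j) ↔ M i j ≠ 0 := by
  classical
  constructor
  · intro h h0
    have hij : i ≠ j := by
      rintro rfl
      simp at h0
    let f : V → Equiv.Perm (Fin 3) :=
      fun k => if k = i then Equiv.swap 0 1 else if k = j then Equiv.swap 1 2 else 1
    have hl : M.IsLiftable f := by
      refine isLiftable_of_isRightAngled hM (fun k => ?_) (fun k l hkl => ?_)
      · simp only [f]
        split_ifs <;> simp
      · simp only [f]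
        split_ifs with h1 h2 h3 h4 h5 h6 <;> try simp
        · subst h1 h3; omega
        · subst h4 h5; rw [M.symmetric] at hkl; omega
    have h' := h.map (cs.lift ⟨f, hl⟩)
    rw [cs.lift_apply_simple hl, cs.lift_apply_simple hl] at h'
    simp only [f, if_pos, if_neg hij.symm] at h'
    exact absurd h' (by unfold Commute SemiconjBy; decide)
  · intro h
    rcases hM i j with h1 | h1 | h1
    · have hij : i = j := by
        by_contra hij
        exact M.off_diagonal i j hij h1
      rw [hij]
    · have := cs.simple_mul_simple_pow i j
      rw [h1, pow_two] at this
      have := eq_inv_of_mul_eq_one_left this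
      rw [mul_inv_rev, cs.inv_simple, cs.inv_simple] at this
      exact this
    · exact absurd h1 h

theorem raIndep_range_simple {M : CoxeterMatrix V} (hM : IsRightAngled M)
    (cs : CoxeterSystem M W) : RAIndep (range cs.simple) := by
  refine ⟨?_, fun H _ f hf l hl hl1 => ?_⟩
  · rintro _ ⟨i, rfl⟩
    simp
  · have hlift : M.IsLiftable (f ∘ cs.simple) :=
      isLiftable_of_isRightAngled hM (fun i => hf.sq _ (mem_range_self i)) fun i j hij =>
        hf.comm _ (mem_range_self i) _ (mem_range_self j)
          ((commute_simple_iff hM cs i j).2 (by omega))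
    have : l.map f = l.map (cs.lift ⟨_, hlift⟩) := by
      refine List.map_congr_left fun x hx => ?_
      obtain ⟨i, rfl⟩ := hl x hx
      rw [cs.lift_apply_simple hlift, comp_apply]
    rw [this, ← map_list_prod, hl1, map_one]

/-- The right-angled Coxeter group with a given Coxeter graph. -/
theorem exists_group_of_graph (G : SimpleGraph V) :
    ∃ (W : Type u) (_ : Group W) (φ : V → W), Injective φ ∧ RAIndep (range φ) ∧
      Subgroup.closure (range φ) = ⊤ ∧ ∀ v w, v ≠ w → (G.Adj v w ↔ Commute (φ v) (φ w)) := by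
  have hM := isRightAngled_raMatrix G
  let cs := (raMatrix G).toCoxeterSystem
  refine ⟨_, _, cs.simple, simple_injective hM cs, raIndep_range_simple hM cs,
    cs.subgroup_closure_range_simple, fun v w hvw => ?_⟩
  rw [commute_simple_iff hM cs]
  nth_rw 1 [← coxeterGraph_raMatrix G]
  exact and_iff_right hvw

theorem range_simple_of_isBasisOfType {S : Set W} {M : CoxeterMatrix S} {cs : CoxeterSystem M W}
    (h : ∀ s : S, cs.simple s = (s : W)) : range cs.simple = S := by
  rw [show cs.simple = Subtype.val from funext h, Subtype.range_coe]

theorem coxeterGraph_eq_commGraph {S : Set W} {M : CoxeterMatrix S} (h : IsBasisOfType S M)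
    (hM : IsRightAngled M) : coxeterGraph M = commGraph S := by
  obtain ⟨cs, hcs⟩ := h
  ext s t
  simp only [coxeterGraph, commGraph]
  rw [← commute_simple_iff hM cs, hcs, hcs]

theorem RAIndep.isBasisOfType {S : Set W} (hS : RAIndep S) (htop : Subgroup.closure S = ⊤) :
    IsBasisOfType S (raMatrix (commGraph S)) := by
  classical
  set M := raMatrix (commGraph S)
  have hM : IsRightAngled M := isRightAngled_raMatrix _
  let cs := M.toCoxeterSystem
  have hadj (s t : S) : M s t = 2 → Commute (s : W) (t : W) := by
    intro h
    have : (coxeterGraph M).Adj s t := by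
      refine ⟨?_, by omega⟩
      rintro rfl
      simp at h
    rw [coxeterGraph_raMatrix] at this
    exact this.2
  have hl : M.IsLiftable (Subtype.val : S → W) :=
    isLiftable_of_isRightAngled hM (fun s => hS.sq s s.2) hadj
  let φ : M.Group →* W := cs.lift ⟨_, hl⟩
  have hφ (s : S) : φ (cs.simple s) = s := cs.lift_apply_simple hl s
  have hsurj : Surjective φ := by
    rw [← MonoidHom.range_eq_top, ← top_le_iff, ← htop, Subgroup.closure_le]
    exact fun s hs => ⟨_, hφ ⟨s, hs⟩⟩
  -- A word in the kernel of `φ` is trivial: apply the defining property of `RAIndep` to the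
  -- assignment of the abstract generators to the elements of `S`.
  have hinj : Injective φ := by
    rw [injective_iff_map_eq_one]
    intro w hw
    obtain ⟨ω, rfl⟩ := cs.wordProd_surjective w
    let f : W → M.Group := fun x => if hx : x ∈ S then cs.simple ⟨x, hx⟩ else 1
    have hf : Respects S f := by
      refine ⟨fun s hs => by simp [f, hs], fun s hs t ht hst => ?_⟩
      simp only [f, dif_pos hs, dif_pos ht]
      rw [commute_simple_iff hM cs]
      by_cases h : (⟨s, hs⟩ : S) = ⟨t, ht⟩
      · simp [h]
      · have : (coxeterGraph M).Adj ⟨s, hs⟩ ⟨t, ht⟩ := by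
          rw [coxeterGraph_raMatrix]
          exact ⟨h, hst⟩
        exact this.2
    have := hS.words _ f hf (ω.map Subtype.val) (by simp +contextual) (by
      rw [CoxeterSystem.wordProd, map_list_prod, List.map_map] at hw
      rw [← hw]
      congr 1
      exact List.map_congr_left fun s _ => (hφ s).symm)
    rw [List.map_map] at this
    rw [CoxeterSystem.wordProd, ← this]
    congr 1
    exact List.map_congr_left fun s _ => by simp [f]
  exact ⟨cs.map (MulEquiv.ofBijective φ ⟨hinj, hsurj⟩), fun s => hφ s⟩

theorem isBasisOfType_iff {S : Set W} :
    (∃ M : CoxeterMatrix S, IsBasisOfType S M ∧ IsRightAngled M) ↔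
      RAIndep S ∧ Subgroup.closure S = ⊤ := by
  constructor
  · rintro ⟨M, ⟨cs, hcs⟩, hM⟩
    have h := raIndep_range_simple hM cs
    have h' := cs.subgroup_closure_range_simple
    rw [range_simple_of_isBasisOfType hcs] at h h'
    exact ⟨h, h'⟩
  · rintro ⟨h, h'⟩
    exact ⟨_, h.isBasisOfType h', isRightAngled_raMatrix _⟩

/-- The universal property of a right-angled Coxeter basis. -/
theorem RAIndep.exists_hom {S : Set W} (hS : RAIndep S) (htop : Subgroup.closure S = ⊤)
    {H : Type u} [Group H] {f : W → H} (hf : Respects S f) :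
    ∃ F : W →* H, ∀ s ∈ S, F s = f s := by
  obtain ⟨M, ⟨cs, hcs⟩, hM⟩ := isBasisOfType_iff.2 ⟨hS, htop⟩
  have hl : M.IsLiftable (fun s : S => f s) :=
    isLiftable_of_isRightAngled hM (fun s => hf.sq s s.2) fun s t hst =>
      hf.comm s s.2 t t.2 (by
        have := (commute_simple_iff hM cs s t).2 (by omega)
        rwa [hcs, hcs] at this)
  refine ⟨cs.lift ⟨_, hl⟩, fun s hs => ?_⟩
  have := cs.lift_apply_simple hl ⟨s, hs⟩
  rwa [hcs] at this

end Coxeter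

/-! ### Letters of words, and conjugates of standard parabolic subgroups -/

section Retraction

variable {W H : Type u} [Group W] [Group H]

/-- The homomorphism onto a group of order two that detects the generator `x` shows that `x` is
conjugate into a standard parabolic subgroup only if it is one of its generators. -/
theorem RAIndep.mem_of_conj_mem_closure {S Y : Set W} (hS : RAIndep S)
    (htop : Subgroup.closure S = ⊤) (hY : Y ⊆ S) {x : W} (hx : x ∈ S) (g : W)
    (h : g * x * g⁻¹ ∈ Subgroup.closure Y) : x ∈ Y := by
  classical
  by_contra hxY
  let a : ULift.{u} (Multiplicative (ZMod 2)) := ⟨Multiplicative.ofAdd 1⟩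
  have ha : a * a = 1 := ULift.ext _ _ (by decide)
  have ha1 : a ≠ 1 := fun h => absurd (congrArg ULift.down h) (by decide)
  obtain ⟨F, hF⟩ := hS.exists_hom htop (f := fun y => if y = x then a else 1)
    ⟨fun s _ => by split_ifs <;> simp [ha], fun _ _ _ _ _ => Commute.all _ _⟩
  have hker : Subgroup.closure Y ≤ F.ker := by
    rw [Subgroup.closure_le]
    intro y hy
    have : y ≠ x := by
      rintro rfl
      exact hxY hy
    simpa [this] using hF y (hY hy)
  have h1 : F (g * x * g⁻¹) = 1 := hker h
  rw [map_mul, map_mul, map_inv, hF x hx, if_pos rfl, mul_inv_cancel_comm] at h1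
  exact ha1 h1

theorem RAIndep.mem_of_mem_closure {S Y : Set W} (hS : RAIndep S)
    (htop : Subgroup.closure S = ⊤) (hY : Y ⊆ S) {x : W} (hx : x ∈ S)
    (h : x ∈ Subgroup.closure Y) : x ∈ Y :=
  hS.mem_of_conj_mem_closure htop hY hx 1 (by simpa using h)

/-- The retraction onto a standard parabolic subgroup. -/
theorem RAIndep.exists_retraction {S Y : Set W} (hS : RAIndep S)
    (htop : Subgroup.closure S = ⊤) (hY : Y ⊆ S) :
    ∃ F : W →* W, (∀ w, F w ∈ Subgroup.closure Y) ∧ ∀ w ∈ Subgroup.closure Y, F w = w := by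
  classical
  have hf : Respects S (fun y => if y ∈ Y then y else 1) := by
    refine ⟨fun s hs => ?_, fun s _ t _ hst => ?_⟩
    · by_cases h : s ∈ Y <;> simp [h, hS.sq s hs]
    · by_cases h : s ∈ Y <;> by_cases h' : t ∈ Y <;> simp [h, h', hst]
  obtain ⟨F, hF⟩ := hS.exists_hom htop hf
  refine ⟨F, fun w => ?_, fun w hw => ?_⟩
  · have : Subgroup.closure S ≤ (Subgroup.closure Y).comap F := by
      rw [Subgroup.closure_le]
      intro s hs
      simp only [Subgroup.coe_comap, mem_preimage, hF s hs]
      split_ifs with h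
      · exact Subgroup.subset_closure h
      · exact one_mem _
    exact this (htop ▸ Subgroup.mem_top w)
  · refine MonoidHom.eqOn_closure (f := F) (g := MonoidHom.id W) (fun y hy => ?_) hw
    simp [hF y (hY hy), hy]

/-- A homomorphism that maps a right-angled basis injectively to an independent set without
creating new commutation relations is injective, because words in the image can be mapped back. -/
theorem RAIndep.injective_of_image {S : Set W} (hS : RAIndep S) (htop : Subgroup.closure S = ⊤)
    (f : W →* H) (hinj : InjOn f S) (himg : RAIndep (f '' S))
    (hcomm : ∀ s ∈ S, ∀ t ∈ S, Commute (f s) (f t) → Commute s t) : Injective f := by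
  rw [injective_iff_map_eq_one]
  intro w hw
  obtain ⟨l, hl, rfl⟩ := exists_word_of_mem_closure hS.sq (x := w) (htop ▸ Subgroup.mem_top w)
  have hinv : LeftInvOn (invFunOn f S) f S := hinj.leftInvOn_invFunOn
  have hg : Respects (f '' S) (invFunOn f S) := by
    refine ⟨?_, ?_⟩
    · rintro _ ⟨s, hs, rfl⟩
      rw [hinv hs, hS.sq s hs]
    · rintro _ ⟨s, hs, rfl⟩ _ ⟨t, ht, rfl⟩ h
      rw [hinv hs, hinv ht]
      exact hcomm s hs t ht h
  have := himg.words W _ hg (l.map f) (by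
    intro x hx
    obtain ⟨y, hy, rfl⟩ := List.mem_map.1 hx
    exact mem_image_of_mem f (hl y hy)) (by rw [← map_list_prod, hw])
  rw [List.map_map, List.map_congr_left (f := invFunOn f S ∘ f) (g := id)
    (fun x hx => hinv (hl x hx))] at this
  simpa using this

theorem conj_image_eq (T : Set W) (g : W) :
    (fun x => g * x * g⁻¹) '' T = (MulAut.conj g).toMonoidHom '' T :=
  rfl

theorem conj_injective (g : W) : Injective (MulAut.conj g).toMonoidHom :=
  (MulAut.conj g).injective

theorem closure_conj_image {T : Set W} {g : W} (hg : g ∈ Subgroup.closure T) :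
    Subgroup.closure ((fun x => g * x * g⁻¹) '' T) = Subgroup.closure T := by
  rw [conj_image_eq, ← MonoidHom.map_closure]
  exact Subgroup.conj_smul_eq_self_of_mem hg

theorem RAIndep.conj_image {T : Set W} (hT : RAIndep T) (g : W) :
    RAIndep ((fun x => g * x * g⁻¹) '' T) := by
  rw [conj_image_eq]
  exact hT.image _ (conj_injective g)

theorem commGraph_conj (T : Set W) (g : W) :
    Nonempty (commGraph T ≃g commGraph ((fun x => g * x * g⁻¹) '' T)) := by
  rw [conj_image_eq]
  exact ⟨commGraphIso _ (conj_injective g) T⟩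

/-- Every subset of a group is the image of a set of elements of the subgroup it generates. -/
theorem exists_generating_preimage {S : Set W} {B : Subgroup W} (h : Subgroup.closure S = B) :
    ∃ S₀ : Set B, B.subtype '' S₀ = S ∧ Subgroup.closure S₀ = ⊤ := by
  subst h
  refine ⟨((↑) : Subgroup.closure S → W) ⁻¹' S, ?_, Subgroup.closure_closure_coe_preimage⟩
  rw [Subgroup.coe_subtype, image_preimage_eq_inter_range, Subtype.range_coe]
  exact inter_eq_left.2 Subgroup.subset_closure

theorem mk_closure_le (S : Set W) :
    Cardinal.mk (Subgroup.closure S) ≤ max (Cardinal.mk S) Cardinal.aleph0 := by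
  rcases S.eq_empty_or_nonempty with rfl | hne
  · rw [Subgroup.closure_empty]
    exact le_max_of_le_right (Cardinal.mk_le_aleph0)
  · have := hne.to_subtype
    rw [FreeGroup.closure_eq_range, ← Cardinal.mk_freeGroup]
    exact Cardinal.mk_le_of_surjective (MonoidHom.rangeRestrict_surjective _)

end Retraction

/-! ### Rigid classes -/

/-- A class of graphs closed under isomorphism all of whose right-angled Coxeter groups are
strongly rigid. -/
structure IsRigidClass (K' : GraphClass.{u}) : Prop where
  iso : K'.IsoClosed
  rigid : ∀ (B : Type u) [Group B], groupsOf K' B → StronglyRigid B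

section Class

variable {K' : GraphClass.{u}} {W M : Type u} [Group W] [Group M]

theorem groupsOf_iff : groupsOf K' W ↔
    ∃ S : Set W, RAIndep S ∧ Subgroup.closure S = ⊤ ∧ K' S (commGraph S) := by
  constructor
  · rintro ⟨S, M, hb, hM, hK⟩
    obtain ⟨h, h'⟩ := isBasisOfType_iff.1 ⟨M, hb, hM⟩
    exact ⟨S, h, h', coxeterGraph_eq_commGraph hb hM ▸ hK⟩
  · rintro ⟨S, h, h', hK⟩
    refine ⟨S, _, h.isBasisOfType h', isRightAngled_raMatrix _, ?_⟩
    rwa [coxeterGraph_raMatrix]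

theorem groupsOf_of_mulEquiv (hK : K'.IsoClosed) (e : W ≃* M) (h : groupsOf K' W) :
    groupsOf K' M := by
  obtain ⟨S, hS, htop, hG⟩ := groupsOf_iff.1 h
  refine groupsOf_iff.2 ⟨e.toMonoidHom '' S, hS.image _ e.injective, ?_,
    hK _ _ _ _ ⟨commGraphIso e.toMonoidHom e.injective S⟩ hG⟩
  rw [← MonoidHom.map_closure, htop, ← MonoidHom.range_eq_map, MonoidHom.range_eq_top]
  exact e.surjective

theorem RAIndep.isBasis {S : Set W} (hS : RAIndep S) (htop : Subgroup.closure S = ⊤) :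
    IsBasis S :=
  ⟨_, hS.isBasisOfType htop⟩

/-- In a member of a rigid class, every Coxeter basis is right-angled, and its graph belongs to the
class of graphs. -/
theorem IsRigidClass.of_isBasis (hK : IsRigidClass K') (hW : groupsOf K' W) {S : Set W}
    (hS : IsBasis S) : RAIndep S ∧ Subgroup.closure S = ⊤ ∧ K' S (commGraph S) := by
  obtain ⟨T, hT, htop, hG⟩ := groupsOf_iff.1 hW
  obtain ⟨g, rfl⟩ := hK.rigid W hW T S (hT.isBasis htop) hS
  refine ⟨hT.conj_image g, ?_, hK.iso _ _ _ _ (commGraph_conj T g) hG⟩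
  rw [closure_conj_image (htop ▸ Subgroup.mem_top g), htop]

theorem IsRigidClass.groupsOf_closure_iff (hK : IsRigidClass K') {S : Set M} (hS : RAIndep S)
    {B : Subgroup M} (hB : Subgroup.closure S = B) : groupsOf K' B ↔ K' S (commGraph S) := by
  obtain ⟨S₀, rfl, htop⟩ := exists_generating_preimage hB
  have hS₀ : RAIndep S₀ := hS.of_image _ B.subtype_injective
  have e := commGraphIso B.subtype B.subtype_injective S₀
  constructor
  · intro h
    exact hK.iso _ _ _ _ ⟨e⟩ (hK.of_isBasis h (hS₀.isBasis htop)).2.2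
  · intro h
    exact groupsOf_iff.2 ⟨S₀, hS₀, htop, hK.iso _ _ _ _ ⟨e.symm⟩ h⟩

/-- Strong rigidity of a subgroup, expressed inside the ambient group. -/
theorem IsRigidClass.exists_conj (hK : IsRigidClass K') {B : Subgroup M} (hB : groupsOf K' B)
    {S T : Set M} (hS : RAIndep S) (hT : RAIndep T) (hSB : Subgroup.closure S = B)
    (hTB : Subgroup.closure T = B) : ∃ g ∈ B, (fun x => g * x * g⁻¹) '' S = T := by
  obtain ⟨S₀, rfl, htop⟩ := exists_generating_preimage hSB
  obtain ⟨T₀, rfl, htop'⟩ := exists_generating_preimage hTB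
  obtain ⟨g, hg⟩ := hK.rigid B hB S₀ T₀
    ((hS.of_image _ B.subtype_injective).isBasis htop)
    ((hT.of_image _ B.subtype_injective).isBasis htop')
  refine ⟨g, g.2, ?_⟩
  rw [← hg, image_image, image_image]
  rfl

theorem exists_raIndep_of_groupsOf {B : Subgroup M} (hB : groupsOf K' B) :
    ∃ S : Set M, RAIndep S ∧ Subgroup.closure S = B := by
  obtain ⟨S, hS, htop, -⟩ := groupsOf_iff.1 hB
  refine ⟨B.subtype '' S, hS.image _ B.subtype_injective, ?_⟩
  rw [← MonoidHom.map_closure, htop, ← MonoidHom.range_eq_map, B.range_subtype]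

/-! ### The parabolic subgroup relation -/

/-- For subgroups `A` and `B` of a common group: `A` is generated by a subset of some right-angled
Coxeter basis of `B`. -/
def Special (A B : Subgroup M) : Prop :=
  ∃ S, RAIndep S ∧ Subgroup.closure S = B ∧ ∃ S' ⊆ S, Subgroup.closure S' = A

theorem special_map_iff (f : W →* M) (hf : Injective f) {A B : Subgroup W} :
    Special (A.map f) (B.map f) ↔ Special A B := by
  constructor
  · rintro ⟨S, hS, hB, S', hS', hA⟩
    have hr : S ⊆ range f := by
      intro s hs
      obtain ⟨b, -, rfl⟩ : s ∈ B.map f := hB ▸ Subgroup.subset_closure hs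
      exact mem_range_self b
    obtain ⟨S, rfl⟩ := subset_range_iff_exists_image_eq.1 hr
    obtain ⟨S', rfl⟩ := subset_range_iff_exists_image_eq.1 (hS'.trans hr)
    rw [← MonoidHom.map_closure] at hA hB
    exact ⟨S, hS.of_image f hf, Subgroup.map_injective hf hB, S',
      (image_subset_image_iff hf).1 hS', Subgroup.map_injective hf hA⟩
  · rintro ⟨S, hS, rfl, S', hS', rfl⟩
    exact ⟨f '' S, hS.image f hf, (MonoidHom.map_closure _ _).symm, f '' S', image_mono hS',
      (MonoidHom.map_closure _ _).symm⟩

theorem IsRigidClass.parabolicRel_iff (hK : IsRigidClass K') {A : Subgroup W} :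
    parabolicRel K' W A ↔ groupsOf K' A ∧ groupsOf K' W ∧ Special A ⊤ := by
  refine and_congr_right fun _ => and_congr_right fun hW => ⟨?_, ?_⟩
  · rintro ⟨S, hS, S', hS', rfl⟩
    have h := hK.of_isBasis hW hS
    exact ⟨S, h.1, h.2.1, S', hS', rfl⟩
  · rintro ⟨S, hS, htop, S', hS', rfl⟩
    exact ⟨S, hS.isBasis htop, S', hS', rfl⟩

theorem groupsOf_subgroupOf_iff (hK : K'.IsoClosed) {A B : Subgroup M} (h : A ≤ B) :
    groupsOf K' (A.subgroupOf B) ↔ groupsOf K' A :=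
  ⟨groupsOf_of_mulEquiv hK (Subgroup.subgroupOfEquivOfLe h),
    groupsOf_of_mulEquiv hK (Subgroup.subgroupOfEquivOfLe h).symm⟩

theorem IsRigidClass.parabolicRel_subgroupOf_iff (hK : IsRigidClass K') {A B : Subgroup M}
    (h : A ≤ B) :
    parabolicRel K' B (A.subgroupOf B) ↔ groupsOf K' A ∧ groupsOf K' B ∧ Special A B := by
  rw [hK.parabolicRel_iff, groupsOf_subgroupOf_iff hK.iso h,
    ← special_map_iff B.subtype B.subtype_injective, Subgroup.map_subgroupOf_eq_of_le h,
    ← MonoidHom.range_eq_map, B.range_subtype]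

/-- By strong rigidity, every basis of a parabolic subgroup extends to a basis of the group. -/
theorem IsRigidClass.exists_extension (hK : IsRigidClass K') {A B : Subgroup M}
    (hA : groupsOf K' A) (hAB : Special A B) {S : Set M} (hS : RAIndep S)
    (hSA : Subgroup.closure S = A) :
    ∃ T, S ⊆ T ∧ RAIndep T ∧ Subgroup.closure T = B := by
  obtain ⟨T, hT, rfl, T', hT', hTA⟩ := hAB
  obtain ⟨g, hg, rfl⟩ := hK.exists_conj hA (hT.mono hT') hS hTA hSA
  refine ⟨_, image_mono hT', hT.conj_image g, closure_conj_image ?_⟩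
  rw [← hTA] at hg
  exact Subgroup.closure_mono hT' hg

theorem IsRigidClass.special_trans (hK : IsRigidClass K') {A B C : Subgroup M}
    (hB : groupsOf K' B) (hAB : Special A B) (hBC : Special B C) : Special A C := by
  obtain ⟨S, hS, hSB, S', hS', hA⟩ := hAB
  obtain ⟨T, hST, hT, hTC⟩ := hK.exists_extension hB hBC hS hSB
  exact ⟨T, hT, hTC, S', hS'.trans hST, hA⟩

/-- If a conjugate `g ⟨X⟩ g⁻¹` of a standard parabolic subgroup lies in the standard parabolic
subgroup `⟨Y⟩`, then `X ⊆ Y`, and the retraction onto `⟨Y⟩` replaces `g` by an element of `⟨Y⟩`. -/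
theorem IsRigidClass.special_of_le (hK : IsRigidClass K') {A B : Subgroup W}
    (hW : groupsOf K' W) (hA : Special A ⊤) (hB : Special B ⊤) (hAB : A ≤ B) : Special A B := by
  obtain ⟨S, hS, hStop, S', hS', rfl⟩ := hA
  obtain ⟨T, hT, hTtop, Y, hY, rfl⟩ := hB
  obtain ⟨g, rfl⟩ := hK.rigid W hW T S (hT.isBasis hTtop) (hS.isBasis hStop)
  obtain ⟨X, hX, rfl⟩ := subset_image_iff.1 hS'
  obtain ⟨F, hF, hFid⟩ := hT.exists_retraction hTtop hY
  have hmem (x : W) (hx : x ∈ X) : g * x * g⁻¹ ∈ Subgroup.closure Y :=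
    hAB (Subgroup.subset_closure (mem_image_of_mem _ hx))
  have hXY : X ⊆ Y := fun x hx => hT.mem_of_conj_mem_closure hTtop hY (hX hx) g (hmem x hx)
  refine ⟨_, (hT.mono hY).conj_image (F g), closure_conj_image (hF g), _, image_mono hXY, ?_⟩
  congr 1
  refine image_congr fun x hx => ?_
  rw [← hFid _ (hmem x hx), map_mul, map_mul, map_inv,
    hFid x (Subgroup.subset_closure (hXY hx))]

end Class

/-! ### Unions of chains -/

section Chains

variable {K' : GraphClass.{u}} {M : Type u} [Group M]

theorem raIndep_biUnion {i : Ordinal.{u}} (hi : 0 < i) {S : Ordinal.{u} → Set M}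
    (hS : ∀ j < i, RAIndep (S j)) (hmono : ∀ j k, j ≤ k → k < i → S j ⊆ S k) :
    RAIndep (⋃ j < i, S j) := by
  have : Nonempty (Iio i) := ⟨⟨0, hi⟩⟩
  have h : (⋃ j < i, S j) = ⋃ j : Iio i, S j := biUnion_eq_iUnion (Iio i) fun j _ => S j
  rw [h]
  refine RAIndep.iUnion (Monotone.directed_le fun j k hjk => ?_) fun j => hS j j.2
  exact hmono j k hjk k.2

theorem closure_biUnion {i : Ordinal.{u}} {S : Ordinal.{u} → Set M} {A : Ordinal.{u} → Subgroup M}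
    (hS : ∀ j < i, Subgroup.closure (S j) = A j) {B : Subgroup M}
    (hB : (B : Set M) = ⋃ j < i, (A j : Set M)) : Subgroup.closure (⋃ j < i, S j) = B := by
  apply le_antisymm
  · rw [Subgroup.closure_le, hB]
    refine iUnion₂_mono fun j hj => ?_
    rw [← hS j hj]
    exact Subgroup.subset_closure
  · intro x hx
    have hx' : x ∈ (B : Set M) := hx
    rw [hB] at hx'
    obtain ⟨j, hj, hxj⟩ := mem_iUnion₂.1 hx'
    rw [← hS j hj] at hxj
    exact Subgroup.closure_mono (subset_biUnion_of_mem (u := S) (show j ∈ Iio i from hj)) hxj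

/-- The members of a continuous chain of parabolic subgroups have bases that increase along the
chain: at successors the basis is extended by `IsRigidClass.exists_extension`, at limits the union
of the previous bases is a basis. -/
theorem IsRigidClass.exists_increasing_bases (hK : IsRigidClass K') {δ : Ordinal.{u}}
    {A : Ordinal.{u} → Subgroup M} (hA : ∀ i < δ, groupsOf K' (A i))
    (hsp : ∀ i j, i ≤ j → j < δ → Special (A i) (A j))
    (hcont : ∀ i < δ, Order.IsSuccLimit i → (A i : Set M) = ⋃ j < i, (A j : Set M)) :
    ∃ S : Ordinal.{u} → Set M, (∀ i < δ, RAIndep (S i)) ∧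
      (∀ i < δ, Subgroup.closure (S i) = A i) ∧ ∀ i j, i ≤ j → j < δ → S i ⊆ S j := by
  classical
  let good (i : Ordinal.{u}) (U T : Set M) : Prop := U ⊆ T ∧ RAIndep T ∧ Subgroup.closure T = A i
  -- By recursion, `S i` is some basis of `A i` that contains all `S j` with `j < i`.
  let step (i : Ordinal.{u}) (ih : ∀ j < i, Set M) : Set M :=
    Classical.epsilon (good i (⋃ (j) (hj : j < i), ih j hj))
  let S : Ordinal.{u} → Set M := wellFounded_lt.fix step
  have hSi (i : Ordinal.{u}) : S i = Classical.epsilon (good i (⋃ j < i, S j)) :=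
    wellFounded_lt.fix_eq step i
  have key : ∀ i < δ, good i (⋃ j < i, S j) (S i) := by
    intro i
    induction i using WellFoundedLT.induction with
    | ind i ih =>
      intro hi
      have ih' (j) (hj : j < i) := ih j hj (hj.trans hi)
      have hmono (j k) (hjk : j ≤ k) (hk : k < i) : S j ⊆ S k := by
        rcases hjk.eq_or_lt with rfl | hlt
        · exact subset_rfl
        · exact (subset_biUnion_of_mem (u := S) (show j ∈ Iio k from hlt)).trans (ih' k hk).1
      rw [hSi i]
      apply Classical.epsilon_spec (p := good i (⋃ j < i, S j))
      rcases Ordinal.zero_or_succ_or_isSuccLimit i with rfl | ⟨k, rfl⟩ | hlim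
      · obtain ⟨T, hT, hTA⟩ := exists_raIndep_of_groupsOf (hA 0 hi)
        exact ⟨T, by simp, hT, hTA⟩
      · have hk : k < Order.succ k := Order.lt_succ k
        obtain ⟨T, hST, hT, hTA⟩ := hK.exists_extension (hA k (hk.trans hi))
          (hsp k _ hk.le hi) (ih' k hk).2.1 (ih' k hk).2.2
        refine ⟨T, iUnion₂_subset fun j hj => ?_, hT, hTA⟩
        exact (hmono j k (Order.lt_succ_iff.1 hj) hk).trans hST
      · exact ⟨_, subset_rfl, raIndep_biUnion hlim.bot_lt (fun j hj => (ih' j hj).2.1) hmono,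
          closure_biUnion (fun j hj => (ih' j hj).2.2) (hcont i hi hlim)⟩
  refine ⟨S, fun i hi => (key i hi).2.1, fun i hi => (key i hi).2.2, fun i j hij hj => ?_⟩
  rcases hij.eq_or_lt with rfl | hlt
  · exact subset_rfl
  · exact (subset_biUnion_of_mem (u := S) (show i ∈ Iio j from hlt)).trans (key j hj).1

/-- The graph induced on a subset of `S` is the commutation graph of that subset. -/
def induceCommGraphIso {S T : Set M} (h : T ⊆ S) :
    (commGraph S).induce {s : S | (s : M) ∈ T} ≃g commGraph T where
  toFun s := ⟨s.1.1, s.2⟩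
  invFun t := ⟨⟨t.1, h t.2⟩, t.2⟩
  left_inv _ := rfl
  right_inv _ := rfl
  map_rel_iff' := by
    intro s t
    simp [commGraph, Subtype.ext_iff]

theorem IsRigidClass.chain (hK : IsRigidClass K') (hlim : K'.ClosedUnderLimits)
    {δ : Ordinal.{u}} (hδ : 0 < δ) {A : Ordinal.{u} → Subgroup M}
    (hA : ∀ i < δ, groupsOf K' (A i)) (hsp : ∀ i j, i ≤ j → j < δ → Special (A i) (A j))
    (hcont : ∀ i < δ, Order.IsSuccLimit i → (A i : Set M) = ⋃ j < i, (A j : Set M))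
    (huniv : (⋃ i < δ, (A i : Set M)) = univ) :
    groupsOf K' M ∧ ∀ j < δ, Special (A j) ⊤ := by
  obtain ⟨S, hS, hSA, hmono⟩ := hK.exists_increasing_bases hA hsp hcont
  set U := ⋃ i < δ, S i with hU
  have hUi : RAIndep U := raIndep_biUnion hδ hS hmono
  have htop : Subgroup.closure U = ⊤ := closure_biUnion hSA (by rw [huniv, Subgroup.coe_top])
  have hsub (i) (hi : i < δ) : S i ⊆ U := subset_biUnion_of_mem (u := S) (show i ∈ Iio δ from hi)
  refine ⟨groupsOf_iff.2 ⟨U, hUi, htop, ?_⟩, fun j hj => ⟨U, hUi, htop, _, hsub j hj, hSA j hj⟩⟩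
  refine hlim δ hδ U (commGraph U) (fun i => {s | (s : M) ∈ S i}) (fun i hi => ?_)
    (fun i j hij hj s hs => hmono i j hij hj hs) (fun i hi hil => ?_) ?_
  · exact hK.iso _ _ _ _ ⟨(induceCommGraphIso (hsub i hi)).symm⟩
      ((hK.groupsOf_closure_iff (hS i hi) (hSA i hi)).1 (hA i hi))
  · refine Subset.antisymm (fun s hs => ?_) (iUnion₂_subset fun j hj s hs =>
      hmono j i hj.le hi hs)
    -- `s` lies in the group `A j` for some `j < i`, hence in its basis `S j`.
    have hsA : (s : M) ∈ (A i : Set M) := by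
      rw [← hSA i hi]
      exact Subgroup.subset_closure hs
    rw [hcont i hi hil] at hsA
    obtain ⟨j, hj, hsj⟩ := mem_iUnion₂.1 hsA
    rw [← hSA j (hj.trans hi)] at hsj
    exact mem_iUnion₂.2 ⟨j, hj, hUi.mem_of_mem_closure htop (hsub j (hj.trans hi)) s.2 hsj⟩
  · refine eq_univ_of_forall fun s => ?_
    obtain ⟨i, hi, hs⟩ := mem_iUnion₂.1 s.2
    exact mem_iUnion₂.2 ⟨i, hi, hs⟩

theorem IsRigidClass.isAECWithoutSmoothnessAndLS (hK : IsRigidClass K')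
    (hlim : K'.ClosedUnderLimits) :
    GroupClass.IsAECWithoutSmoothnessAndLS (groupsOf K') (parabolicRel K') where
  class_iso := by
    rintro B B' _ _ ⟨e⟩ h
    exact groupsOf_of_mulEquiv hK.iso e h
  rel_iso := by
    intro B B' _ _ f A h
    obtain ⟨hA, hB, hsp⟩ := hK.parabolicRel_iff.1 h
    refine hK.parabolicRel_iff.2 ⟨groupsOf_of_mulEquiv hK.iso (f.subgroupMap A) hA,
      groupsOf_of_mulEquiv hK.iso f hB, ?_⟩
    rw [← special_map_iff f.toMonoidHom f.injective, ← MonoidHom.range_eq_map,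
      MonoidHom.range_eq_top.2 f.surjective] at hsp
    exact hsp
  rel_mem _ _ _ h := ⟨h.1, h.2.1⟩
  refl := by
    intro B _ hB
    obtain ⟨S, hS, htop, -⟩ := groupsOf_iff.1 hB
    exact hK.parabolicRel_iff.2 ⟨groupsOf_of_mulEquiv hK.iso Subgroup.topEquiv.symm hB, hB,
      S, hS, htop, S, subset_rfl, htop⟩
  antisymm _ _ _ _ hAB _ hBA _ := le_antisymm hAB hBA
  trans := by
    intro C _ A B hAB h1 h2
    obtain ⟨hA, hB, hsp⟩ := (hK.parabolicRel_subgroupOf_iff hAB).1 h1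
    obtain ⟨-, hC, hsp'⟩ := hK.parabolicRel_iff.1 h2
    exact hK.parabolicRel_iff.2 ⟨hA, hC, hK.special_trans hB hsp hsp'⟩
  chain := by
    intro δ hδ M _ A hA hle hcont huniv
    obtain ⟨hM, hsp⟩ := hK.chain hlim hδ hA (fun i j hij hj =>
      ((hK.parabolicRel_subgroupOf_iff (hle i j hij hj).1).1 (hle i j hij hj).2).2.2) hcont huniv
    exact ⟨hM, fun j hj => hK.parabolicRel_iff.2 ⟨hA j hj, hM, hsp j hj⟩⟩
  coherence := by
    intro C _ A B hA hB hC h1 h2 hAB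
    exact (hK.parabolicRel_subgroupOf_iff hAB).2 ⟨hA, hB, hK.special_of_le hC
      (hK.parabolicRel_iff.1 h1).2.2 (hK.parabolicRel_iff.1 h2).2.2 hAB⟩

end Chains

/-! ### Löwenheim–Skolem numbers -/

section LS

variable {K' : GraphClass.{u}}

/-- The right-angled Coxeter group of a member of the class of graphs, with its vertices as
generators. -/
theorem exists_mem_groupsOf (hK : K'.IsoClosed) {V : Type u} {G : SimpleGraph V} (hG : K' V G) :
    ∃ (W : Type u) (_ : Group W) (φ : V → W), Injective φ ∧ RAIndep (range φ) ∧
      Subgroup.closure (range φ) = ⊤ ∧ (∀ v w, v ≠ w → (G.Adj v w ↔ Commute (φ v) (φ w))) ∧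
      groupsOf K' W := by
  obtain ⟨W, _, φ, hφ, hS, htop, hadj⟩ := exists_group_of_graph G
  have e : G ≃g commGraph (range φ) :=
    { toEquiv := Equiv.ofInjective φ hφ
      map_rel_iff' := by
        intro v w
        by_cases h : v = w
        · simp [h]
        · simp [commGraph, Subtype.ext_iff, hφ.eq_iff, h, hadj v w h] }
  exact ⟨W, _, φ, hφ, hS, htop, hadj,
    groupsOf_iff.2 ⟨_, hS, htop, hK _ _ _ _ ⟨e⟩ hG⟩⟩

/-- A set of group elements is contained in the subgroup generated by the letters of words that
represent its elements, and there are not many of these letters. -/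
theorem exists_letters {A : Type u} [Group A] {S : Set A} (hS : RAIndep S)
    (htop : Subgroup.closure S = ⊤) (X : Set A) :
    ∃ Y : Set S, X ⊆ Subgroup.closure (Subtype.val '' Y : Set A) ∧
      Cardinal.mk Y ≤ max (Cardinal.mk X) Cardinal.aleph0 := by
  choose l hl hprod using fun x : A =>
    exists_word_of_mem_closure hS.sq (x := x) (htop ▸ Subgroup.mem_top x)
  refine ⟨⋃ x : X, {s : S | (s : A) ∈ l x}, fun x hx => ?_, ?_⟩
  · rw [SetLike.mem_coe, ← hprod x]
    refine Subgroup.list_prod_mem _ fun y hy => Subgroup.subset_closure ?_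
    exact ⟨⟨y, hl x y hy⟩, mem_iUnion_of_mem ⟨x, hx⟩ hy, rfl⟩
  · have hfin (x : X) : Cardinal.mk {s : S | (s : A) ∈ l x} ≤ Cardinal.aleph0 :=
      Set.Countable.le_aleph0 (((l x).finite_toSet.preimage Subtype.val_injective.injOn).countable)
    calc _ ≤ Cardinal.sum fun x : X => Cardinal.mk {s : S | (s : A) ∈ l x} :=
          Cardinal.mk_iUnion_le_sum_mk
      _ ≤ Cardinal.sum fun _ : X => Cardinal.aleph0 := Cardinal.sum_le_sum _ _ hfin
      _ = Cardinal.mk X * Cardinal.aleph0 := by simp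
      _ ≤ max (max (Cardinal.mk X) Cardinal.aleph0) Cardinal.aleph0 := Cardinal.mul_le_max _ _
      _ = _ := by simp

theorem IsRigidClass.hasLSProperty_of_graph (hK : IsRigidClass K') {κ : Cardinal.{u}}
    (hκ : Cardinal.aleph0 ≤ κ) (h : K'.HasLSProperty κ) :
    GroupClass.HasLSProperty (groupsOf K') (parabolicRel K') κ := by
  intro A _ hA X
  obtain ⟨S, hS, htop, hG⟩ := groupsOf_iff.1 hA
  obtain ⟨Y₀, hXY, hcard⟩ := exists_letters hS htop X
  obtain ⟨Y, hY₀, hYG, hY⟩ := h S _ hG Y₀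
  have hYS : Subtype.val '' Y ⊆ S := by simp
  have hmem : groupsOf K' (Subgroup.closure (Subtype.val '' Y : Set A)) := by
    rw [hK.groupsOf_closure_iff (hS.mono hYS) rfl]
    refine hK.iso _ _ _ _ ⟨?_⟩ hYG
    have e := induceCommGraphIso hYS
    rwa [show {s : S | (s : A) ∈ Subtype.val '' Y} = Y by ext s; simp] at e
  refine ⟨_, hXY.trans (Subgroup.closure_mono (image_mono hY₀)), hmem,
    hK.parabolicRel_iff.2 ⟨hmem, hA, S, hS, htop, _, hYS, rfl⟩, (mk_closure_le _).trans ?_⟩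
  rw [Cardinal.mk_image_eq Subtype.val_injective]
  refine max_le (hY.trans ?_) (hκ.trans (self_le_add_left _ _))
  calc Cardinal.mk Y₀ + κ ≤ Cardinal.mk X + Cardinal.aleph0 + κ := by
        gcongr
        exact hcard.trans (max_le (self_le_add_right _ _) (self_le_add_left _ _))
    _ = _ := by rw [add_assoc, Cardinal.add_eq_right hκ hκ]

theorem IsRigidClass.graph_hasLSProperty (hK : IsRigidClass K') {κ : Cardinal.{u}}
    (h : GroupClass.HasLSProperty (groupsOf K') (parabolicRel K') κ) : K'.HasLSProperty κ := by
  intro V G hG X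
  obtain ⟨W, _, φ, hφ, hS, htop, hadj, hW⟩ := exists_mem_groupsOf hK.iso hG
  obtain ⟨C, hXC, hC, hrel, hcard⟩ := h W hW (φ '' X)
  obtain ⟨-, -, T, hT, hTtop, T', hT', rfl⟩ := hK.parabolicRel_iff.1 hrel
  obtain ⟨g, rfl⟩ := hK.rigid W hW _ _ (hS.isBasis htop) (hT.isBasis hTtop)
  obtain ⟨Z, hZ, rfl⟩ := subset_image_iff.1 hT'
  obtain ⟨Y, rfl⟩ := subset_range_iff_exists_image_eq.1 hZ
  have hconj : Subgroup.closure ((fun x => g * x * g⁻¹) '' (φ '' Y)) =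
      (Subgroup.closure (φ '' Y)).map (MulAut.conj g).toMonoidHom := by
    rw [conj_image_eq, MonoidHom.map_closure]
  have e : G.induce Y ≃g commGraph (φ '' Y) :=
    { toEquiv := Equiv.Set.image φ Y hφ
      map_rel_iff' := by
        intro v w
        by_cases h : (v : V) = w
        · simp [h]
        · simp [commGraph, Subtype.ext_iff, hφ.eq_iff, h, hadj v w h] }
  refine ⟨Y, fun x hx => ?_, ?_, ?_⟩
  · have hx' : φ x ∈ Subgroup.closure ((fun x => g * x * g⁻¹) '' (φ '' Y)) :=
      hXC (mem_image_of_mem φ hx)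
    rw [hconj] at hx'
    obtain ⟨y, hy, hyx⟩ := hx'
    have hy' : g⁻¹ * φ x * g⁻¹⁻¹ ∈ Subgroup.closure (φ '' Y) := by
      rw [← hyx]
      simpa [mul_assoc] using hy
    exact hφ.mem_set_image.1 (hS.mem_of_conj_mem_closure htop hZ (mem_range_self x) _ hy')
  · obtain ⟨e'⟩ := commGraph_conj (φ '' Y) g
    exact hK.iso _ _ _ _ ⟨(e.trans e').symm⟩
      ((hK.groupsOf_closure_iff (hT.mono hT') rfl).1 hC)
  · rw [Cardinal.mk_image_eq hφ] at hcard
    refine le_trans ?_ hcard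
    refine Cardinal.mk_le_of_injective
      (f := fun y : Y => ⟨g * φ y * g⁻¹, Subgroup.subset_closure ⟨_, ⟨_, y.2, rfl⟩, rfl⟩⟩) ?_
    intro y z hyz
    exact Subtype.ext (hφ (mul_left_cancel (mul_right_cancel (congrArg Subtype.val hyz))))

theorem IsRigidClass.isLSNumber_iff (hK : IsRigidClass K') (κ : Cardinal.{u}) :
    GroupClass.IsLSNumber (groupsOf K') (parabolicRel K') κ ↔ K'.IsLSNumber κ := by
  have : {μ : Cardinal.{u} | Cardinal.aleph0 ≤ μ ∧
      GroupClass.HasLSProperty (groupsOf K') (parabolicRel K') μ} =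
      {μ | Cardinal.aleph0 ≤ μ ∧ K'.HasLSProperty μ} := by
    ext μ
    exact and_congr_right fun hμ => ⟨hK.graph_hasLSProperty, hK.hasLSProperty_of_graph hμ⟩
  rw [GroupClass.IsLSNumber, GraphClass.IsLSNumber, this]

end LS

/-! ### Amalgamation, joint embedding and large models -/

section Embeddings

variable {K' : GraphClass.{u}}

/-- An induced subgraph embedding of Coxeter graphs extends to a strong embedding of groups. -/
theorem IsRigidClass.exists_strongEmbedding (hK : IsRigidClass K') {B W U : Type u} [Group B]
    [Group W] {T : Set B} (hT : RAIndep T) (htop : Subgroup.closure T = ⊤)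
    (hB : groupsOf K' B) (hW : groupsOf K' W) {C : SimpleGraph U} {φ : U → W} (hφ : Injective φ)
    (hφi : RAIndep (range φ)) (hφtop : Subgroup.closure (range φ) = ⊤)
    (hadj : ∀ v w, v ≠ w → (C.Adj v w ↔ Commute (φ v) (φ w))) (f : commGraph T ↪g C) :
    ∃ F : B →* W, GroupClass.IsStrongEmbedding (parabolicRel K') F ∧
      ∀ t : T, F t = φ (f t) := by
  classical
  have hcomm (s t : T) : Commute (φ (f s)) (φ (f t)) ↔ Commute (s : B) (t : B) := by
    by_cases h : s = t
    · simp [h]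
    · rw [← hadj _ _ (f.injective.ne h), f.map_adj_iff]
      exact and_iff_right h
  obtain ⟨F, hF⟩ := hT.exists_hom htop
    (f := fun b => if hb : b ∈ T then φ (f ⟨b, hb⟩) else 1)
    ⟨fun s hs => by simpa [hs] using hφi.sq _ (mem_range_self _), fun s hs t ht hst => by
      simpa [hs, ht] using (hcomm ⟨s, hs⟩ ⟨t, ht⟩).2 hst⟩
  have hF' (t : T) : F t = φ (f t) := by simpa using hF t t.2
  have hsub : F '' T ⊆ range φ := by
    rintro _ ⟨t, ht, rfl⟩
    exact ⟨_, (hF' ⟨t, ht⟩).symm⟩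
  have hinj : Injective F := by
    refine hT.injective_of_image htop F (fun s hs t ht h => ?_) (hφi.mono hsub)
      fun s hs t ht h => ?_
    · rw [hF' ⟨s, hs⟩, hF' ⟨t, ht⟩] at h
      exact congrArg Subtype.val (f.injective (hφ h))
    · rw [hF' ⟨s, hs⟩, hF' ⟨t, ht⟩] at h
      exact (hcomm _ _).1 h
  refine ⟨F, ⟨hinj, hK.parabolicRel_iff.2
    ⟨groupsOf_of_mulEquiv hK.iso (MonoidHom.ofInjective hinj) hB, hW, _, hφi, hφtop, _, hsub, ?_⟩⟩,
    hF'⟩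
  rw [← MonoidHom.map_closure, htop, ← MonoidHom.range_eq_map]

theorem IsRigidClass.jep (hK : IsRigidClass K') (h : K'.JEP) :
    GroupClass.JEP (groupsOf K') (parabolicRel K') := by
  intro B₀ B₁ _ _ hB₀ hB₁
  obtain ⟨T₀, hT₀, htop₀, hG₀⟩ := groupsOf_iff.1 hB₀
  obtain ⟨T₁, hT₁, htop₁, hG₁⟩ := groupsOf_iff.1 hB₁
  obtain ⟨U, C, hC, ⟨f₀⟩, ⟨f₁⟩⟩ := h _ _ _ _ hG₀ hG₁
  obtain ⟨W, _, φ, hφ, hS, htop, hadj, hW⟩ := exists_mem_groupsOf hK.iso hC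
  obtain ⟨F₀, hF₀, -⟩ := hK.exists_strongEmbedding hT₀ htop₀ hB₀ hW hφ hS htop hadj f₀
  obtain ⟨F₁, hF₁, -⟩ := hK.exists_strongEmbedding hT₁ htop₁ hB₁ hW hφ hS htop hadj f₁
  exact ⟨W, _, F₀, F₁, hW, hF₀, hF₁⟩

/-- A strong embedding maps a given basis into a suitable basis of the codomain. -/
theorem IsRigidClass.exists_basis_of_strongEmbedding (hK : IsRigidClass K') {A B : Type u}
    [Group A] [Group B] {S : Set A} (hS : RAIndep S) (htop : Subgroup.closure S = ⊤)
    {e : A →* B} (he : GroupClass.IsStrongEmbedding (parabolicRel K') e) :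
    ∃ T : Set B, e '' S ⊆ T ∧ RAIndep T ∧ Subgroup.closure T = ⊤ ∧ K' T (commGraph T) := by
  obtain ⟨hr, hB, hsp⟩ := hK.parabolicRel_iff.1 he.2
  obtain ⟨T, hST, hT, hTtop⟩ := hK.exists_extension hr hsp (hS.image e he.1)
    (by rw [← MonoidHom.map_closure, htop, ← MonoidHom.range_eq_map])
  exact ⟨T, hST, hT, hTtop, (hK.of_isBasis hB (hT.isBasis hTtop)).2.2⟩

/-- An injective homomorphism that maps `S` into `T` embeds the commutation graphs. -/
def commGraphEmbedding {A B : Type u} [Group A] [Group B] (e : A →* B) (he : Injective e)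
    {S : Set A} {T : Set B} (h : e '' S ⊆ T) : commGraph S ↪g commGraph T where
  toFun s := ⟨e s, h (mem_image_of_mem e s.2)⟩
  inj' s t hst := Subtype.ext (he (congrArg Subtype.val hst))
  map_rel_iff' := by
    intro s t
    refine and_congr (not_congr ?_) (commute_map_iff he)
    exact Subtype.ext_iff.trans (he.eq_iff.trans Subtype.ext_iff.symm)

theorem IsRigidClass.ap (hK : IsRigidClass K') (h : K'.AP) :
    GroupClass.AP (groupsOf K') (parabolicRel K') := by
  intro A B₀ B₁ _ _ _ hA hB₀ hB₁ e₀ e₁ he₀ he₁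
  obtain ⟨S, hS, htop, hG⟩ := groupsOf_iff.1 hA
  obtain ⟨T₀, hST₀, hT₀, htop₀, hG₀⟩ := hK.exists_basis_of_strongEmbedding hS htop he₀
  obtain ⟨T₁, hST₁, hT₁, htop₁, hG₁⟩ := hK.exists_basis_of_strongEmbedding hS htop he₁
  obtain ⟨U, C, f₀, f₁, hC, hf⟩ := h _ _ _ _ _ _ hG hG₀ hG₁
    (commGraphEmbedding e₀ he₀.1 hST₀) (commGraphEmbedding e₁ he₁.1 hST₁)
  obtain ⟨W, _, φ, hφ, hφi, hφtop, hadj, hW⟩ := exists_mem_groupsOf hK.iso hC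
  obtain ⟨F₀, hF₀, hF₀'⟩ := hK.exists_strongEmbedding hT₀ htop₀ hB₀ hW hφ hφi hφtop hadj f₀
  obtain ⟨F₁, hF₁, hF₁'⟩ := hK.exists_strongEmbedding hT₁ htop₁ hB₁ hW hφ hφi hφtop hadj f₁
  refine ⟨W, _, F₀, F₁, hW, hF₀, hF₁, fun a => ?_⟩
  have heq : F₀.comp e₀ = F₁.comp e₁ := by
    refine MonoidHom.eq_of_eqOn_dense htop fun s hs => ?_
    have h₀ := hF₀' (commGraphEmbedding e₀ he₀.1 hST₀ ⟨s, hs⟩)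
    have h₁ := hF₁' (commGraphEmbedding e₁ he₁.1 hST₁ ⟨s, hs⟩)
    rw [hf, ← h₁] at h₀
    exact h₀
  exact DFunLike.congr_fun heq a

theorem IsRigidClass.alm (hK : IsRigidClass K') (h : K'.ALM) :
    GroupClass.ALM (groupsOf K') (parabolicRel K') := by
  obtain ⟨κ, hκ, hmod⟩ := h
  refine ⟨κ, (hK.isLSNumber_iff κ).2 hκ, fun μ hμ => ?_⟩
  obtain ⟨V, G, hG, rfl⟩ := hmod μ hμ
  obtain ⟨W, _, φ, hφ, -, htop, -, hW⟩ := exists_mem_groupsOf hK.iso hG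
  refine ⟨W, _, hW, le_antisymm ?_ (Cardinal.mk_le_of_injective hφ)⟩
  have := mk_closure_le (range φ)
  rwa [Cardinal.mk_range_eq φ hφ, max_eq_left (hκ.1.1.trans hμ), htop,
    Cardinal.mk_congr Subgroup.topEquiv.toEquiv] at this

end Embeddings

end RACG

theorem mainTheorem3 (K' : GraphClass.{u}) (hiso : K'.IsoClosed) (hlim : K'.ClosedUnderLimits)
    (hrigid : ∀ (B : Type u) [Group B], RACG.groupsOf K' B → RACG.StronglyRigid B) :
    GroupClass.IsAECWithoutSmoothnessAndLS (RACG.groupsOf K') (RACG.parabolicRel K') ∧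
    (∀ κ : Cardinal.{u},
      GroupClass.IsLSNumber (RACG.groupsOf K') (RACG.parabolicRel K') κ ↔ K'.IsLSNumber κ) ∧
    (K'.AP → GroupClass.AP (RACG.groupsOf K') (RACG.parabolicRel K')) ∧
    (K'.JEP → GroupClass.JEP (RACG.groupsOf K') (RACG.parabolicRel K')) ∧
    (K'.ALM → GroupClass.ALM (RACG.groupsOf K') (RACG.parabolicRel K')) := by
  have hK : RACG.IsRigidClass K' := ⟨hiso, hrigid⟩
  exact ⟨hK.isAECWithoutSmoothnessAndLS hlim, hK.isLSNumber_iff, hK.ap, hK.jep, hK.alm⟩
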